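/- Let $n\ge 1$ be an integer, let $G$ be any graph, and let $M_1,\dots,M_{3n-2}$ be matchings in $G$ (not necessarily distinct), each consisting of exactly $n$ edges. Then there is a rainbow matching of size $n$ for $(M_1,\dots,M_{3n-2})$, that is, a matching $R$ in $G$ with exactly $n$ edges for which there is an injective map $f\colon R\to\{1,\dots,3n-2\}$ such that $e\in M_{f(e)}$ for every edge $e\in R$. -/

import Mathlib

/-- A rainbow matching for a system `C` of sets of edges of a graph `G`: a matching `R` of `G`
each of whose edges is chosen from a different member of the system, i.e. there is an injective
assignment `f` of indices to the edges of `R` such that every edge `e` belongs to `C (f e)`.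
Not every member of the system need be represented. The system is indexed, so equal sets with
different indices count as different members. -/
def IsRainbowMatching {V : Type*} {G : SimpleGraph V} {ι : Type*}
    (C : ι → Set (Sym2 V)) (R : G.Subgraph) : Prop :=
  R.IsMatching ∧
    ∃ f : R.edgeSet → ι, Function.Injective f ∧ ∀ e : R.edgeSet, (e : Sym2 V) ∈ C (f e)

/-! A rainbow matching is enlarged one edge at a time. Let `F` be rainbow with `k < n` edges and
suppose no rainbow matching has `k + 1`. Represent some indices by one edge each, including all of
`F`. Every matching in the set `H` of representatives is rainbow, so `H` has matching number `k`.
Call a vertex missable if some `k`-edge matching in `H` misses it; all vertices outside `F` are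
missable.

By `MatchingBound.exists_edge_grow`, each unused `m i`, having more than `k` edges, contains an edge
whose addition to `H` makes a new vertex missable, necessarily one of the `2k` vertices of `F`.
After `k + (2k + 1)` indices this is impossible.

The growth lemma follows Gallai–Edmonds theory. A non-missable neighbour of a missable vertex is
deleted, lowering `k` by one (`missableVerts_stability`). When none is left, Gallai's lemma splits
the missable vertices into classes, and parity in each class bounds the larger matching
(`MatchingBound.card_le_of_separated`). -/

section EdgeMatching

variable {V ι : Type*}

/-! ### Matchings as finite sets of edges -/

/-- A finite set of pairwise disjoint non-loop edges. -/
def IsEdgeMatching (N : Finset (Sym2 V)) : Prop :=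
  (∀ e ∈ N, ¬ e.IsDiag) ∧ ∀ e ∈ N, ∀ f ∈ N, ∀ x, x ∈ e → x ∈ f → e = f

theorem IsEdgeMatching.subset {N N' : Finset (Sym2 V)} (h : IsEdgeMatching N) (hs : N' ⊆ N) :
    IsEdgeMatching N' :=
  ⟨fun e he => h.1 e (hs he), fun e he f hf => h.2 e (hs he) f (hs hf)⟩

/-- The edges of `N` can be chosen from distinct members of the system `m`. -/
def IsRainbowSet (m : ι → Finset (Sym2 V)) (N : Finset (Sym2 V)) : Prop :=
  ∃ f : Sym2 V → ι, Set.InjOn f N ∧ ∀ e ∈ N, e ∈ m (f e)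

/-- Choosing an edge from each of several members yields rainbow sets only. -/
theorem isRainbowSet_of_subset_image [Nonempty ι] {m : ι → Finset (Sym2 V)} {C : Set ι}
    {g : ι → Sym2 V} (hg : ∀ c ∈ C, g c ∈ m c) {N : Finset (Sym2 V)}
    (hN : (N : Set (Sym2 V)) ⊆ g '' C) : IsRainbowSet m N := by
  choose! f hfC hf using hN
  refine ⟨f, ?_, ?_⟩
  · intro e he e' he' h
    rw [← hf he, ← hf he', h]
  · intro e he
    have := hg _ (hfC he)
    rwa [hf he] at this

variable [DecidableEq V]

/-- The vertices covered by a finite set of edges. -/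
def coveredVerts (N : Finset (Sym2 V)) : Finset V := N.biUnion Sym2.toFinset

theorem mem_coveredVerts {N : Finset (Sym2 V)} {x : V} :
    x ∈ coveredVerts N ↔ ∃ e ∈ N, x ∈ e := by
  simp [coveredVerts]

theorem IsEdgeMatching.card_coveredVerts {N : Finset (Sym2 V)} (h : IsEdgeMatching N) :
    (coveredVerts N).card = 2 * N.card := by
  rw [coveredVerts, Finset.card_biUnion, Finset.sum_const_nat (m := 2), mul_comm]
  · intro e he
    exact Sym2.card_toFinset_of_not_isDiag e (h.1 e he)
  · intro e he f hf hne
    refine Finset.disjoint_left.2 fun x hx hx' => ?_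
    exact hne (h.2 e he f hf x (by simpa using hx) (by simpa using hx'))

theorem IsEdgeMatching.insert_edge {N : Finset (Sym2 V)} (h : IsEdgeMatching N) {x y : V} (hxy : x ≠ y)
    (hx : x ∉ coveredVerts N) (hy : y ∉ coveredVerts N) :
    IsEdgeMatching (insert s(x, y) N) := by
  have key : ∀ f ∈ N, ∀ z, z ∈ s(x, y) → z ∉ f := by
    intro f hf z hz hzf
    rcases Sym2.mem_iff.1 hz with rfl | rfl
    · exact hx (mem_coveredVerts.2 ⟨f, hf, hzf⟩)
    · exact hy (mem_coveredVerts.2 ⟨f, hf, hzf⟩)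
  refine ⟨?_, ?_⟩
  · intro e he
    rcases Finset.mem_insert.1 he with rfl | he
    · simpa using hxy
    · exact h.1 e he
  · intro e he f hf z hze hzf
    rcases Finset.mem_insert.1 he with rfl | he <;> rcases Finset.mem_insert.1 hf with rfl | hf
    · rfl
    · exact absurd hzf (key f hf z hze)
    · exact absurd hze (key e he z hzf)
    · exact h.2 e he f hf z hze hzf

theorem card_insert_of_notMem_coveredVerts {N : Finset (Sym2 V)} {x y : V}
    (hx : x ∉ coveredVerts N) : (insert s(x, y) N).card = N.card + 1 :=
  Finset.card_insert_of_notMem fun h => hx (mem_coveredVerts.2 ⟨_, h, by simp⟩)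

theorem mem_coveredVerts_insert {N : Finset (Sym2 V)} {x y z : V} :
    z ∈ coveredVerts (insert s(x, y) N) ↔ z = x ∨ z = y ∨ z ∈ coveredVerts N := by
  simp only [mem_coveredVerts, Finset.exists_mem_insert, Sym2.mem_iff, or_assoc]

theorem coveredVerts_mono {N N' : Finset (Sym2 V)} (h : N ⊆ N') :
    coveredVerts N ⊆ coveredVerts N' :=
  Finset.biUnion_subset_biUnion_of_subset_left _ h

theorem IsEdgeMatching.notMem_coveredVerts_erase {N : Finset (Sym2 V)} (h : IsEdgeMatching N)
    {f : Sym2 V} (hf : f ∈ N) {x : V} (hx : x ∈ f) : x ∉ coveredVerts (N.erase f) := by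
  intro hc
  obtain ⟨e, he, hxe⟩ := mem_coveredVerts.1 hc
  rw [Finset.mem_erase] at he
  exact he.1 (h.2 e he.2 f hf x hxe hx)

/-! ### Exchange between two matchings -/

/-- Moving a matching `N'` towards `N` without covering the vertices in `Z`. -/
theorem IsEdgeMatching.exchange {N : Finset (Sym2 V)} (hN : IsEdgeMatching N) (Z : Finset V)
    {N' : Finset (Sym2 V)} (hN' : IsEdgeMatching N') (hZ : Disjoint Z (coveredVerts N')) :
    ∃ L : Finset (Sym2 V), IsEdgeMatching L ∧ L ⊆ N' ∪ N ∧ L.card = N'.card ∧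
      Disjoint Z (coveredVerts L) ∧
      (coveredVerts N ⊆ coveredVerts L ∪ Z ∨
        ∃ x y, s(x, y) ∈ N ∧ x ∉ Z ∧ x ∉ coveredVerts L ∧ y ∉ coveredVerts L) := by
  induction hm : (N \ N').card using Nat.strong_induction_on generalizing N' with
  | _ m ih =>
  by_cases hsub : coveredVerts N ⊆ coveredVerts N' ∪ Z
  · exact ⟨N', hN', Finset.subset_union_left, rfl, hZ, Or.inl hsub⟩
  obtain ⟨x, hxN, hx⟩ := Finset.not_subset.1 hsub
  simp only [Finset.mem_union, not_or] at hx
  obtain ⟨e, heN, hxe⟩ := mem_coveredVerts.1 hxN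
  obtain ⟨y, rfl⟩ := Sym2.mem_iff_exists.1 hxe
  by_cases hy : y ∈ coveredVerts N'
  swap
  · exact ⟨N', hN', Finset.subset_union_left, rfl, hZ, Or.inr ⟨x, y, heN, hx.2, hx.1, hy⟩⟩
  obtain ⟨f, hf, hyf⟩ := mem_coveredVerts.1 hy
  have hxy : x ≠ y := by simpa using hN.1 _ heN
  have hx' : x ∉ coveredVerts (N'.erase f) := fun h =>
    hx.1 (coveredVerts_mono (Finset.erase_subset _ _) h)
  have hy' := hN'.notMem_coveredVerts_erase hf hyf
  have heN' : s(x, y) ∉ N' := fun h => hx.1 (mem_coveredVerts.2 ⟨_, h, by simp⟩)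
  have hfN : f ∉ N := fun h => heN' (by rwa [← hN.2 f h _ heN y hyf (by simp)])
  -- Trading `f` for `s(x, y)` gains an edge of `N` and loses none, since `f` meets `s(x, y)` at `y`
  -- and so is not in `N`.
  have hlt : (N \ insert s(x, y) (N'.erase f)).card < m := by
    rw [← hm]
    refine Finset.card_lt_card (Finset.ssubset_iff_of_subset ?_ |>.2
      ⟨s(x, y), by simp [heN, heN'], by simp⟩)
    intro g hg
    simp only [Finset.mem_sdiff, Finset.mem_insert, Finset.mem_erase, not_or, not_and] at hg ⊢
    exact ⟨hg.1, hg.2.2 fun h => hfN (h ▸ hg.1)⟩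
  have hZ' : Disjoint Z (coveredVerts (insert s(x, y) (N'.erase f))) := by
    rw [Finset.disjoint_left] at hZ ⊢
    intro z hz h
    rcases mem_coveredVerts_insert.1 h with rfl | rfl | h
    · exact hx.2 hz
    · exact hZ hz hy
    · exact hZ hz (coveredVerts_mono (Finset.erase_subset _ _) h)
  obtain ⟨L, hL, hLs, hLc, hLZ, h⟩ :=
    ih _ hlt ((hN'.subset (Finset.erase_subset _ _)).insert_edge hxy hx' hy') hZ' rfl
  refine ⟨L, hL, hLs.trans ?_, ?_, hLZ, h⟩
  · intro g hg
    simp only [Finset.mem_union, Finset.mem_insert, Finset.mem_erase] at hg ⊢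
    rcases hg with (rfl | hg) | hg
    · exact Or.inr heN
    · exact Or.inl hg.2
    · exact Or.inr hg
  · rw [hLc, card_insert_of_notMem_coveredVerts hx', Finset.card_erase_add_one hf]

/-! ### Missable vertices, Gallai's lemma and stability -/

/-- Every matching contained in `H` has at most `k` edges. -/
def MatchingBound (H : Set (Sym2 V)) (k : ℕ) : Prop :=
  ∀ N : Finset (Sym2 V), IsEdgeMatching N → (N : Set (Sym2 V)) ⊆ H → N.card ≤ k

/-- The vertices missed by some matching in `H` with exactly `k` edges. -/
def missableVerts (H : Set (Sym2 V)) (k : ℕ) : Set V :=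
  {v | ∃ N : Finset (Sym2 V), IsEdgeMatching N ∧ (N : Set (Sym2 V)) ⊆ H ∧ N.card = k ∧
    v ∉ coveredVerts N}

theorem missableVerts_mono {H H' : Set (Sym2 V)} (h : H ⊆ H') (k : ℕ) :
    missableVerts H k ⊆ missableVerts H' k := by
  rintro v ⟨N, h1, h2, h3⟩
  exact ⟨N, h1, h2.trans h, h3⟩

theorem coe_insert_subset {H : Set (Sym2 V)} {N : Finset (Sym2 V)} {e : Sym2 V}
    (he : e ∈ H) (h : (N : Set (Sym2 V)) ⊆ H) : ((insert e N : Finset _) : Set (Sym2 V)) ⊆ H := by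
  rw [Finset.coe_insert]
  exact Set.insert_subset he h

/-- A maximum matching covers an endpoint of each edge. -/
theorem MatchingBound.mem_or_mem {H : Set (Sym2 V)} {k : ℕ} (hH : MatchingBound H k)
    {N : Finset (Sym2 V)} (hN : IsEdgeMatching N) (hNH : (N : Set (Sym2 V)) ⊆ H) (hk : N.card = k)
    {x y : V} (hxy : x ≠ y) (he : s(x, y) ∈ H) : x ∈ coveredVerts N ∨ y ∈ coveredVerts N := by
  by_contra! h
  have := hH _ (hN.insert_edge hxy h.1 h.2) (coe_insert_subset he hNH)
  rw [card_insert_of_notMem_coveredVerts h.1] at this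
  omega

/-- Gallai's lemma: not being missed simultaneously by a maximum matching is transitive on
the missable vertices. -/
theorem MatchingBound.gallai {H : Set (Sym2 V)} {k : ℕ} (hH : MatchingBound H k) {u t v : V}
    (huv : u ≠ v) (ht : t ∈ missableVerts H k)
    (hut : ∀ N : Finset (Sym2 V), IsEdgeMatching N → (N : Set (Sym2 V)) ⊆ H → N.card = k →
      u ∈ coveredVerts N ∨ t ∈ coveredVerts N)
    (htv : ∀ N : Finset (Sym2 V), IsEdgeMatching N → (N : Set (Sym2 V)) ⊆ H → N.card = k →
      t ∈ coveredVerts N ∨ v ∈ coveredVerts N)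
    {N : Finset (Sym2 V)} (hN : IsEdgeMatching N) (hNH : (N : Set (Sym2 V)) ⊆ H)
    (hk : N.card = k) : u ∈ coveredVerts N ∨ v ∈ coveredVerts N := by
  by_contra! h
  obtain ⟨N', hN', hN'H, hk', htN'⟩ := ht
  obtain ⟨L, hL, hLs, hLc, hLZ, hcov⟩ := hN.exchange {t} hN' (by simpa using htN')
  rw [Finset.disjoint_singleton_left] at hLZ
  have hLH : (L : Set (Sym2 V)) ⊆ H := by
    intro e he
    rcases Finset.mem_union.1 (hLs he) with h | h
    · exact hN'H h
    · exact hNH h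
  rcases hcov with hcov | ⟨x, y, hxyN, -, hx, hy⟩
  -- `L` misses `t`, so it covers `u` and `v` as well as all of `N`'s vertices except possibly `t`:
  -- at least `2k + 1` vertices, one too many.
  · have huL := (hut L hL hLH (hLc.trans hk')).resolve_right hLZ
    have hvL := (htv L hL hLH (hLc.trans hk')).resolve_left hLZ
    have hsub : insert u (insert v ((coveredVerts N).erase t)) ⊆ coveredVerts L := by
      intro z hz
      simp only [Finset.mem_insert, Finset.mem_erase] at hz
      rcases hz with rfl | rfl | ⟨hzt, hz⟩
      · exact huL
      · exact hvL
      · simpa [hzt] using hcov hz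
    have hc := Finset.card_le_card hsub
    rw [Finset.card_insert_of_notMem (by simp [huv, h.1]),
      Finset.card_insert_of_notMem (by simp [h.2]), hL.card_coveredVerts] at hc
    have := Finset.pred_card_le_card_erase (s := coveredVerts N) (a := t)
    rw [hN.card_coveredVerts] at this
    omega
  · rcases hH.mem_or_mem hL hLH (hLc.trans hk') (by simpa using hN.1 _ hxyN) (hNH hxyN) with h | h
    · exact hx h
    · exact hy h

/-- The stability lemma: deleting the edges at a non-missable vertex with a missable neighbour
makes no further vertex missable. -/
theorem missableVerts_stability {H : Set (Sym2 V)} {k : ℕ} {a d : V}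
    (ha : a ∉ missableVerts H (k + 1)) (hd : d ∈ missableVerts H (k + 1)) (had : s(a, d) ∈ H) :
    missableVerts {e ∈ H | a ∉ e} k ⊆ insert a (missableVerts H (k + 1)) := by
  rintro v ⟨N', hN', hN'H, hk', hvN'⟩
  by_contra hv
  simp only [Set.mem_insert_iff, not_or] at hv
  obtain ⟨hva, hv⟩ := hv
  have haN' : a ∉ coveredVerts N' := by
    intro h
    obtain ⟨e, he, hae⟩ := mem_coveredVerts.1 h
    exact (hN'H he).2 hae
  have had' : a ≠ d := fun h => ha (h ▸ hd)
  have hvd : v ≠ d := fun h => hv (h ▸ hd)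
  obtain ⟨N, hN, hNH, hk, hdN⟩ := hd
  obtain ⟨L, hL, hLs, hLc, hLZ, hcov⟩ := hN.exchange {a, v} hN' (by simp [haN', hvN'])
  have haL : a ∉ coveredVerts L := Finset.disjoint_left.1 hLZ (by simp)
  have hvL : v ∉ coveredVerts L := Finset.disjoint_left.1 hLZ (by simp)
  have hLH : (L : Set (Sym2 V)) ⊆ H := by
    intro e he
    rcases Finset.mem_union.1 (hLs he) with h | h
    · exact (hN'H h).1
    · exact hNH h
  -- Adding `s(x, y)` to `L` gives `k + 1` edges of `H`, which must cover every non-missable vertex.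
  have key : ∀ x y, x ≠ y → s(x, y) ∈ H → x ∉ coveredVerts L → y ∉ coveredVerts L → ∀ z,
      z ∉ missableVerts H (k + 1) → z ∉ coveredVerts L → z = x ∨ z = y := by
    intro x y hxy he hx hy z hz hzL
    by_contra! hne
    refine hz ⟨_, hL.insert_edge hxy hx hy, coe_insert_subset he hLH, ?_, ?_⟩
    · rw [card_insert_of_notMem_coveredVerts hx, hLc, hk']
    · rw [mem_coveredVerts_insert]
      tauto
  rcases hcov with hcov | ⟨x, y, hxyN, hxZ, hx, hy⟩
  · have hdL : d ∈ coveredVerts L := by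
      by_contra hdL
      rcases key a d had' had haL hdL v hv hvL with h | h
      · exact hva h
      · exact hvd h
    -- `L` would cover at least `2(k + 1) - 2 + 1` vertices, but it has only `k` edges.
    have hsub : insert d (((coveredVerts N).erase a).erase v) ⊆ coveredVerts L := by
      intro z hz
      simp only [Finset.mem_insert, Finset.mem_erase] at hz
      rcases hz with rfl | ⟨hzv, hza, hz⟩
      · exact hdL
      · simpa [hzv, hza] using hcov hz
    have hc := Finset.card_le_card hsub
    rw [Finset.card_insert_of_notMem (by simp [hdN]), hL.card_coveredVerts] at hc
    have h1 := Finset.pred_card_le_card_erase (s := coveredVerts N) (a := a)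
    have h2 := Finset.pred_card_le_card_erase (s := (coveredVerts N).erase a) (a := v)
    rw [hN.card_coveredVerts] at h1
    omega
  · simp only [Finset.mem_insert, Finset.mem_singleton, not_or] at hxZ
    have hxy : x ≠ y := by simpa using hN.1 _ hxyN
    have h1 := key x y hxy (hNH hxyN) hx hy a ha haL
    have h2 := key x y hxy (hNH hxyN) hx hy v hv hvL
    have h1' := h1.resolve_left (Ne.symm hxZ.1)
    have h2' := h2.resolve_left (Ne.symm hxZ.2)
    exact hva (h2'.trans h1'.symm)

/-! ### The separated case: parity in Gallai classes -/

/-- If each edge of a matching meeting `P` lies inside `P`, it covers an even number of vertices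
of `P`. -/
theorem IsEdgeMatching.even_card_filter {N : Finset (Sym2 V)} (h : IsEdgeMatching N)
    (P : V → Prop) [DecidablePred P] (hP : ∀ x y, s(x, y) ∈ N → P x → P y) :
    Even ((coveredVerts N).filter P).card := by
  classical
  have hcov : (coveredVerts N).filter P = coveredVerts (N.filter fun e => ∀ x ∈ e, P x) := by
    ext x
    simp only [Finset.mem_filter, mem_coveredVerts]
    constructor
    · rintro ⟨⟨e, he, hx⟩, hPx⟩
      refine ⟨e, ⟨he, ?_⟩, hx⟩
      obtain ⟨y, rfl⟩ := Sym2.mem_iff_exists.1 hx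
      intro z hz
      rcases Sym2.mem_iff.1 hz with rfl | rfl
      · exact hPx
      · exact hP _ _ he hPx
    · rintro ⟨e, ⟨he, hPe⟩, hx⟩
      exact ⟨⟨e, he, hx⟩, hPe x hx⟩
  rw [hcov, (h.subset (Finset.filter_subset _ _)).card_coveredVerts]
  exact even_two_mul _

/-- If no edge of `H` joins a missable vertex to a non-missable one, the edges of a larger matching
cannot all respect this partition and the relation in Gallai's lemma. -/
theorem MatchingBound.card_le_of_separated {H : Set (Sym2 V)} {k : ℕ} (hH : MatchingBound H k)
    (hsep : ∀ x y, s(x, y) ∈ H → x ∈ missableVerts H k → y ∈ missableVerts H k)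
    {N M : Finset (Sym2 V)} (hN : IsEdgeMatching N) (hNH : (N : Set (Sym2 V)) ⊆ H)
    (hk : N.card = k) (hM : IsEdgeMatching M)
    (hMsep : ∀ x y, s(x, y) ∈ M → x ∈ missableVerts H k → y ∈ missableVerts H k)
    (hMrel : ∀ x y, s(x, y) ∈ M → ∀ L : Finset (Sym2 V), IsEdgeMatching L →
      (L : Set (Sym2 V)) ⊆ H → L.card = k → x ∈ coveredVerts L ∨ y ∈ coveredVerts L) :
    M.card ≤ k := by
  classical
  -- For missable `u`, `r u` is the Gallai class of `u`; a `k`-edge matching in `H` misses at most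
  -- one vertex of it.
  let r : V → V → Prop := fun u x => x ∈ missableVerts H k ∧
    (u = x ∨ ∀ L : Finset (Sym2 V), IsEdgeMatching L →
      (L : Set (Sym2 V)) ⊆ H → L.card = k → u ∈ coveredVerts L ∨ x ∈ coveredVerts L)
  have htrans : ∀ u x y, r u x → r x y → r u y := by
    rintro u x y ⟨hx, h1⟩ ⟨hy, h2⟩
    refine ⟨hy, ?_⟩
    rcases h1 with rfl | h1
    · exact h2
    rcases h2 with rfl | h2
    · exact Or.inr h1
    by_cases huy : u = y
    · exact Or.inl huy
    · exact Or.inr fun L hL hLH hLk => hH.gallai huy hx h1 h2 hL hLH hLk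
  have hmiss : ∀ x, x ∉ coveredVerts N → x ∈ missableVerts H k := fun x hx => ⟨N, hN, hNH, hk, hx⟩
  -- Otherwise `M` covers, in the class of `u`, exactly the vertices covered by `N` together with
  -- `u`; but both numbers are even.
  have hex : ∀ u ∈ coveredVerts M \ coveredVerts N,
      ∃ w ∈ coveredVerts N \ coveredVerts M, r u w := by
    intro u hu
    rw [Finset.mem_sdiff] at hu
    by_contra! hno
    have e1 := hN.even_card_filter (r u) fun x y hxy hx => htrans _ _ _ hx
      ⟨hsep x y (hNH hxy) hx.1, Or.inr fun L hL hLH hLk =>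
        hH.mem_or_mem hL hLH hLk (by simpa using hN.1 _ hxy) (hNH hxy)⟩
    have e2 := hM.even_card_filter (r u) fun x y hxy hx => htrans _ _ _ hx
      ⟨hMsep x y hxy hx.1, Or.inr (hMrel x y hxy)⟩
    have heq : (coveredVerts M).filter (r u) = insert u ((coveredVerts N).filter (r u)) := by
      ext x
      simp only [Finset.mem_filter, Finset.mem_insert]
      constructor
      · rintro ⟨hxM, hx⟩
        by_cases hxN : x ∈ coveredVerts N
        · exact Or.inr ⟨hxN, hx⟩
        · rcases hx.2 with h | h
          · exact Or.inl h.symm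
          · exact absurd (h N hN hNH hk) (by simp [hu.2, hxN])
      · rintro (rfl | ⟨hxN, hx⟩)
        · exact ⟨hu.1, hmiss _ hu.2, Or.inl rfl⟩
        · refine ⟨?_, hx⟩
          by_contra hxM
          exact hno x (Finset.mem_sdiff.2 ⟨hxN, hxM⟩) hx
    rw [heq, Finset.card_insert_of_notMem (by simp [hu.2])] at e2
    exact Nat.not_even_iff_odd.2 e1.add_one e2
  choose! w hw hrw using hex
  have hcard : (coveredVerts M \ coveredVerts N).card ≤ (coveredVerts N \ coveredVerts M).card := by
    refine Finset.card_le_card_of_injOn w hw ?_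
    intro u hu u' hu' heq
    rw [Finset.mem_coe] at hu hu'
    have h1 := hrw u hu
    have h2 := hrw u' hu'
    rw [← heq] at h2
    have huN := (Finset.mem_sdiff.1 hu).2
    have huN' := (Finset.mem_sdiff.1 hu').2
    -- A common `w` would put `u` and `u'` in one class, and `N` misses both.
    have h3 : r (w u) u' := by
      refine ⟨hmiss _ huN', ?_⟩
      rcases h2.2 with h | h
      · exact Or.inl h.symm
      · exact Or.inr fun L hL hLH hLk => (h L hL hLH hLk).symm
    rcases (htrans _ _ _ h1 h3).2 with h | h
    · exact h
    · exact absurd (h N hN hNH hk) (by simp [huN, huN'])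
  have h1 := Finset.card_sdiff_add_card_inter (coveredVerts M) (coveredVerts N)
  have h2 := Finset.card_sdiff_add_card_inter (coveredVerts N) (coveredVerts M)
  rw [Finset.inter_comm, hN.card_coveredVerts] at h2
  rw [hM.card_coveredVerts] at h1
  omega

/-! ### Deleting a vertex, and the growth lemma -/

/-- Deleting from a matching the edge at a covered vertex. -/
theorem IsEdgeMatching.card_filter_notMem {N : Finset (Sym2 V)} (h : IsEdgeMatching N) (a : V) :
    N.card ≤ (N.filter fun e => a ∉ e).card + 1 := by
  have h1 := Finset.card_filter_add_card_filter_not (s := N) (fun e => a ∈ e)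
  have h2 : (N.filter fun e => a ∈ e).card ≤ 1 := by
    rw [Finset.card_le_one]
    intro e he f hf
    rw [Finset.mem_filter] at he hf
    exact h.2 e he.1 f hf.1 a he.2 hf.2
  omega

/-- A maximum matching minus its edge at `a` is a maximum matching avoiding `a`. -/
theorem MatchingBound.card_filter_notMem_eq {H : Set (Sym2 V)} {k : ℕ} {a : V}
    (hH : MatchingBound {e ∈ H | a ∉ e} k) {N : Finset (Sym2 V)} (hN : IsEdgeMatching N)
    (hNH : (N : Set (Sym2 V)) ⊆ H) (hk : N.card = k + 1) :
    ((N.filter fun e => a ∉ e : Finset _) : Set (Sym2 V)) ⊆ {e ∈ H | a ∉ e} ∧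
      (N.filter fun e => a ∉ e).card = k := by
  have hsub : ((N.filter fun e => a ∉ e : Finset _) : Set (Sym2 V)) ⊆ {e ∈ H | a ∉ e} := by
    intro e he
    rw [Finset.mem_coe, Finset.mem_filter] at he
    exact ⟨hNH he.1, he.2⟩
  refine ⟨hsub, ?_⟩
  have h1 := hN.card_filter_notMem a
  have h2 := hH _ (hN.subset (Finset.filter_subset _ _)) hsub
  omega

theorem MatchingBound.delete {H : Set (Sym2 V)} {k : ℕ} (hH : MatchingBound H (k + 1)) {a : V}
    (ha : a ∉ missableVerts H (k + 1)) : MatchingBound {e ∈ H | a ∉ e} k := by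
  intro N hN hNH
  have hNH' : (N : Set (Sym2 V)) ⊆ H := hNH.trans (Set.sep_subset _ _)
  have h1 := hH N hN hNH'
  by_contra! h2
  refine ha ⟨N, hN, hNH', by omega, ?_⟩
  intro h
  obtain ⟨e, he, hae⟩ := mem_coveredVerts.1 h
  exact (hNH he).2 hae

/-- A matching larger than all those in `H` has an edge whose addition to `H` increases the
matching number or the set of missable vertices. -/
theorem MatchingBound.exists_edge_grow {k : ℕ} {H : Set (Sym2 V)} (hH : MatchingBound H k)
    {N M : Finset (Sym2 V)} (hN : IsEdgeMatching N) (hNH : (N : Set (Sym2 V)) ⊆ H)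
    (hk : N.card = k) (hM : IsEdgeMatching M) (hkM : k < M.card)
    (hbound : ∀ e ∈ M, MatchingBound (insert e H) k) :
    ∃ e ∈ M, ¬ missableVerts (insert e H) k ⊆ missableVerts H k := by
  by_contra! hD
  induction k generalizing H N M with
  | zero =>
    obtain ⟨e, he⟩ := Finset.card_pos.1 hkM
    have := hbound e he {e} (hM.subset (by simpa using he)) (by simp)
    simp at this
  | succ k ih =>
  by_cases hsep : ∀ x y, s(x, y) ∈ H → x ∈ missableVerts H (k + 1) → y ∈ missableVerts H (k + 1)
  · refine absurd (hH.card_le_of_separated hsep hN hNH hk hM ?_ ?_) (by omega)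
    -- If `y` were not missable, trading `L`'s edge `s(y, w)` for `s(x, y)` would make `w` missable,
    -- so by `hD` already missable in `H`; then `s(w, y)` violates `hsep`.
    · rintro x y hxy ⟨L, hL, hLH, hLk, hx⟩
      by_contra hy
      have hne : x ≠ y := by simpa using hM.1 _ hxy
      have hyL : y ∈ coveredVerts L := by
        by_contra hyL
        exact hy ⟨L, hL, hLH, hLk, hyL⟩
      obtain ⟨f, hf, hyf⟩ := mem_coveredVerts.1 hyL
      obtain ⟨w, rfl⟩ := Sym2.mem_iff_exists.1 hyf
      have hyw : y ≠ w := by simpa using hL.1 _ hf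
      have hwx : w ≠ x := fun h => hx (mem_coveredVerts.2 ⟨_, hf, by simp [h]⟩)
      have hx' : x ∉ coveredVerts (L.erase s(y, w)) := fun h =>
        hx (coveredVerts_mono (Finset.erase_subset _ _) h)
      have hy' := hL.notMem_coveredVerts_erase hf hyf
      have hw' : w ∉ coveredVerts (L.erase s(y, w)) := hL.notMem_coveredVerts_erase hf (by simp)
      have hw : w ∈ missableVerts (insert s(x, y) H) (k + 1) := by
        refine ⟨_, (hL.subset (Finset.erase_subset _ _)).insert_edge hne hx' hy',
          coe_insert_subset (Set.mem_insert _ _) ?_, ?_, ?_⟩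
        · exact fun g hg => Set.mem_insert_of_mem _ (hLH (Finset.mem_of_mem_erase hg))
        · rw [card_insert_of_notMem_coveredVerts hx', Finset.card_erase_add_one hf, hLk]
        · rw [mem_coveredVerts_insert]
          simp [hwx, hyw.symm, hw']
      exact hy (hsep w y (Sym2.eq_swap ▸ hLH hf) (hD _ hxy hw))
    · intro x y hxy L hL hLH hLk
      exact (hbound _ hxy).mem_or_mem hL (hLH.trans (Set.subset_insert _ _)) hLk
        (by simpa using hM.1 _ hxy) (Set.mem_insert _ _)
  · push Not at hsep
    obtain ⟨d, a, hda, hd, ha⟩ := hsep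
    rw [Sym2.eq_swap] at hda
    -- Deleting `a` lowers the matching number by one and costs `M` at most one edge, so the
    -- induction hypothesis applies to what avoids `a`.
    have hH' := hH.delete ha
    obtain ⟨hs, hc⟩ := hH'.card_filter_notMem_eq hN hNH hk
    have hins : ∀ e, a ∉ e → insert e {e ∈ H | a ∉ e} = {f ∈ insert e H | a ∉ f} := by
      intro e hae
      ext f
      simp only [Set.mem_insert_iff, Set.mem_ofPred_eq]
      constructor
      · rintro (rfl | h)
        · exact ⟨Or.inl rfl, hae⟩
        · exact ⟨Or.inr h.1, h.2⟩
      · rintro ⟨rfl | h, h'⟩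
        · exact Or.inl rfl
        · exact Or.inr ⟨h, h'⟩
    have hcM := hM.card_filter_notMem a
    refine ih hH' (hN.subset (Finset.filter_subset _ _)) hs hc
      (hM.subset (Finset.filter_subset (fun e => a ∉ e) M)) (by omega) ?_ ?_
    · intro e he
      rw [Finset.mem_filter] at he
      rw [hins e he.2]
      exact (hbound e he.1).delete fun h => ha (hD e he.1 h)
    · intro e he
      rw [Finset.mem_filter] at he
      rw [hins e he.2]
      -- By stability only `a` and the old missable vertices can be missable after deletion, and all
      -- of these are missable in `H` without `a`.
      refine (missableVerts_stability (fun h => ha (hD e he.1 h))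
        (missableVerts_mono (Set.subset_insert _ _) _ hd) (Set.mem_insert_of_mem _ hda)).trans ?_
      rintro v (rfl | hv)
      · refine ⟨_, hN.subset (Finset.filter_subset _ _), hs, hc, ?_⟩
        intro h
        obtain ⟨f, hf, hvf⟩ := mem_coveredVerts.1 h
        exact (hs hf).2 hvf
      · obtain ⟨L, hL, hLH, hLk, hvL⟩ := hD e he.1 hv
        obtain ⟨hs', hc'⟩ := hH'.card_filter_notMem_eq hL hLH hLk
        exact ⟨_, hL.subset (Finset.filter_subset _ _), hs', hc',
          fun h => hvL (coveredVerts_mono (Finset.filter_subset _ _) h)⟩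

/-! ### Enlarging a rainbow matching -/

/-- A rainbow matching with `k < n` edges is not of maximum size, when at least `3 * k + 1`
matchings of size `n` are given. -/
theorem exists_isRainbowSet_succ [Fintype ι] {m : ι → Finset (Sym2 V)} {n k : ℕ}
    (hm : ∀ i, IsEdgeMatching (m i)) (hcard : ∀ i, (m i).card = n) (hkn : k < n)
    (hι : 3 * k < Fintype.card ι) {F : Finset (Sym2 V)} (hF : IsEdgeMatching F)
    (hFr : IsRainbowSet m F) (hFk : F.card = k) :
    ∃ R : Finset (Sym2 V), IsEdgeMatching R ∧ IsRainbowSet m R ∧ R.card = k + 1 := by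
  classical
  have : Nonempty ι := Fintype.card_pos_iff.1 (by omega)
  by_contra! hno
  have hbound : ∀ (C : Finset ι) (g : ι → Sym2 V), (∀ c ∈ C, g c ∈ m c) →
      MatchingBound (g '' C) k := by
    intro C g hg N hN hNg
    by_contra! hlt
    obtain ⟨R, hRN, hRc⟩ := Finset.exists_subset_card_eq (s := N) (n := k + 1) hlt
    exact hno R (hN.subset hRN) (isRainbowSet_of_subset_image hg
      ((Finset.coe_subset.2 hRN).trans hNg)) hRc
  -- The value `j = 2 * k + 1` exceeds the number of vertices of `F`. Reaching it uses at most `3 *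
  -- k + 1` indices.
  have hgrow : ∀ j, j ≤ 2 * k + 1 → ∃ (C : Finset ι) (g : ι → Sym2 V), (∀ c ∈ C, g c ∈ m c) ∧
      (F : Set (Sym2 V)) ⊆ g '' C ∧ C.card ≤ k + j ∧
      j ≤ ((coveredVerts F).filter fun v => v ∈ missableVerts (g '' C) k).card := by
    intro j hj
    induction j with
    | zero =>
      obtain ⟨f, hf, hfm⟩ := hFr
      -- `g` inverts `f` on `F`; for empty `F` any edge serves as the default value.
      obtain ⟨g, hg⟩ : ∃ g : ι → Sym2 V, ∀ e ∈ F, g (f e) = e := by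
        rcases F.eq_empty_or_nonempty with rfl | ⟨e₀, -⟩
        · obtain ⟨i⟩ := this
          have hpos : 0 < (m i).card := by rw [hcard]; omega
          obtain ⟨e, -⟩ := Finset.card_pos.1 hpos
          exact ⟨fun _ => e, by simp⟩
        · have : Nonempty (Sym2 V) := ⟨e₀⟩
          exact ⟨Function.invFunOn f F, fun e he => hf.leftInvOn_invFunOn he⟩
      refine ⟨F.image f, g, ?_, ?_, ?_, Nat.zero_le _⟩
      · intro c hc
        obtain ⟨e, he, rfl⟩ := Finset.mem_image.1 hc
        rw [hg e he]
        exact hfm e he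
      · intro e he
        exact ⟨f e, by simpa using ⟨e, he, rfl⟩, hg e he⟩
      · exact Finset.card_image_le.trans (by omega)
    | succ j ih =>
      obtain ⟨C, g, hg, hFC, hC, hj'⟩ := ih (by omega)
      obtain ⟨i, hi⟩ : ∃ i, i ∉ C := by
        by_contra! h
        have : C = Finset.univ := Finset.eq_univ_iff_forall.2 h
        rw [this, Finset.card_univ] at hC
        omega
      have himage : ∀ e, Function.update g i e '' (insert i C : Finset ι) = insert e (g '' C) := by
        intro e
        rw [Finset.coe_insert, Set.image_insert_eq, Function.update_self]
        congr 1
        refine Set.image_congr fun c hc => Function.update_of_ne ?_ _ _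
        rintro rfl
        exact hi hc
      have hupd : ∀ e ∈ m i, ∀ c ∈ insert i C, Function.update g i e c ∈ m c := by
        intro e he c hc
        by_cases hci : c = i
        · subst hci
          simpa using he
        · rw [Function.update_of_ne hci]
          exact hg c ((Finset.mem_insert.1 hc).resolve_left hci)
      obtain ⟨e, he, hnot⟩ := (hbound C g hg).exists_edge_grow hF hFC hFk (hm i)
        (by rw [hcard]; exact hkn) (fun e he => himage e ▸ hbound _ _ (hupd e he))
      obtain ⟨v, hv, hv'⟩ := Set.not_subset.1 hnot
      refine ⟨insert i C, Function.update g i e, hupd e he, ?_, ?_, ?_⟩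
      · rw [himage]
        exact hFC.trans (Set.subset_insert _ _)
      · rw [Finset.card_insert_of_notMem hi]
        omega
      · rw [himage]
        refine hj'.trans_lt (Finset.card_lt_card (Finset.ssubset_iff_of_subset ?_ |>.2
          ⟨v, ?_, by simp [hv']⟩))
        · exact Finset.monotone_filter_right _ fun x _ hx =>
            missableVerts_mono (Set.subset_insert _ _) _ hx
        · refine Finset.mem_filter.2 ⟨?_, hv⟩
          -- A vertex outside `F` is already missable, by `F` itself.
          by_contra hvF
          exact hv' ⟨F, hF, hFC, hFk, hvF⟩
  obtain ⟨C, g, -, -, -, h⟩ := hgrow _ le_rfl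
  have h' := h.trans (Finset.card_filter_le _ _)
  rw [hF.card_coveredVerts] at h'
  omega

/-- Enlargement from `k` to `k + 1` edges needs `3k + 1` matchings; the last step, `k = n - 1`,
needs exactly `3n - 2`. -/
theorem exists_isRainbowSet [Fintype ι] {m : ι → Finset (Sym2 V)} {n : ℕ} (hn : 1 ≤ n)
    (hm : ∀ i, IsEdgeMatching (m i)) (hcard : ∀ i, (m i).card = n)
    (hι : Fintype.card ι = 3 * n - 2) :
    ∃ R : Finset (Sym2 V), IsEdgeMatching R ∧ IsRainbowSet m R ∧ R.card = n := by
  have h : ∀ k ≤ n, ∃ R : Finset (Sym2 V), IsEdgeMatching R ∧ IsRainbowSet m R ∧ R.card = k := by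
    intro k hk
    induction k with
    | zero =>
      have : Nonempty ι := Fintype.card_pos_iff.1 (by omega)
      exact ⟨∅, by simp [IsEdgeMatching], by simp [IsRainbowSet], rfl⟩
    | succ k ih =>
      obtain ⟨F, hF, hFr, hFk⟩ := ih (by omega)
      exact exists_isRainbowSet_succ hm hcard hk (by omega) hF hFr hFk
  exact h n le_rfl

end EdgeMatching

/-! ### Translation to and from subgraphs -/

theorem SimpleGraph.Subgraph.IsMatching.isEdgeMatching {V : Type*} {G : SimpleGraph V}
    {M : G.Subgraph} (hM : M.IsMatching) {N : Finset (Sym2 V)}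
    (hN : (N : Set (Sym2 V)) = M.edgeSet) : IsEdgeMatching N := by
  have hmem : ∀ e, e ∈ N ↔ e ∈ M.edgeSet := fun e => by rw [← hN, Finset.mem_coe]
  refine ⟨fun e he => G.not_isDiag_of_mem_edgeSet (M.edgeSet_subset ((hmem e).1 he)), ?_⟩
  intro e he f hf x hxe hxf
  obtain ⟨y, rfl⟩ := Sym2.mem_iff_exists.1 hxe
  obtain ⟨z, rfl⟩ := Sym2.mem_iff_exists.1 hxf
  rw [hmem, SimpleGraph.Subgraph.mem_edgeSet] at he hf
  rw [hM.eq_of_adj_left he hf]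

/-- The subgraph formed by a finite set of edges of `G`. -/
def subgraphOfEdges {V : Type*} {G : SimpleGraph V} (N : Finset (Sym2 V))
    (hN : (N : Set (Sym2 V)) ⊆ G.edgeSet) : G.Subgraph where
  verts := {v | ∃ e ∈ N, v ∈ e}
  Adj x y := s(x, y) ∈ N
  adj_sub h := hN h
  edge_vert h := ⟨_, h, by simp⟩
  symm := ⟨fun x y h => by rwa [Sym2.eq_swap]⟩

theorem edgeSet_subgraphOfEdges {V : Type*} {G : SimpleGraph V} (N : Finset (Sym2 V))
    (hN : (N : Set (Sym2 V)) ⊆ G.edgeSet) : (subgraphOfEdges N hN).edgeSet = N := by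
  ext e
  induction e with
  | _ x y => exact SimpleGraph.Subgraph.mem_edgeSet

theorem IsEdgeMatching.isMatching_subgraphOfEdges {V : Type*} {G : SimpleGraph V}
    {N : Finset (Sym2 V)} (h : IsEdgeMatching N) (hN : (N : Set (Sym2 V)) ⊆ G.edgeSet) :
    (subgraphOfEdges N hN).IsMatching := by
  rintro v ⟨e, he, hv⟩
  obtain ⟨w, rfl⟩ := Sym2.mem_iff_exists.1 hv
  refine ⟨w, he, fun y hy => ?_⟩
  exact Sym2.congr_right.1 (h.2 _ hy _ he v (by simp) (by simp))

theorem mainTheorem1 {V : Type*} (G : SimpleGraph V) (n : ℕ) (hn : 1 ≤ n)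
    (M : Fin (3 * n - 2) → G.Subgraph)
    (hM : ∀ i, (M i).IsMatching)
    (hcard : ∀ i, (M i).edgeSet.encard = n) :
    ∃ R : G.Subgraph,
      IsRainbowMatching (fun i => (M i).edgeSet) R ∧ R.edgeSet.encard = n := by
  classical
  have hfin : ∀ i, (M i).edgeSet.Finite := fun i => Set.finite_of_encard_eq_coe (hcard i)
  let m : Fin (3 * n - 2) → Finset (Sym2 V) := fun i => (hfin i).toFinset
  have hm : ∀ i, (m i : Set (Sym2 V)) = (M i).edgeSet := fun i => (hfin i).coe_toFinset
  have hmc : ∀ i, (m i).card = n := by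
    intro i
    have h := hcard i
    rw [← hm i, Set.encard_coe_eq_coe_finsetCard] at h
    exact_mod_cast h
  obtain ⟨R, hR, ⟨f, hf, hfm⟩, hRn⟩ := exists_isRainbowSet hn
    (fun i => (hM i).isEdgeMatching (hm i)) hmc (Fintype.card_fin _)
  have hfM : ∀ e ∈ R, e ∈ (M (f e)).edgeSet := fun e he => by
    rw [← hm]
    exact hfm e he
  have hRG : (R : Set (Sym2 V)) ⊆ G.edgeSet := fun e he => (M (f e)).edgeSet_subset (hfM e he)
  have hmem : ∀ e : (subgraphOfEdges R hRG).edgeSet, (e : Sym2 V) ∈ R := fun e =>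
    (edgeSet_subgraphOfEdges R hRG).subset e.2
  refine ⟨subgraphOfEdges R hRG, ⟨hR.isMatching_subgraphOfEdges hRG, fun e => f e, ?_, ?_⟩, ?_⟩
  · intro e e' h
    exact Subtype.ext (hf (hmem e) (hmem e') h)
  · exact fun e => hfM e (hmem e)
  · rw [edgeSet_subgraphOfEdges, Set.encard_coe_eq_coe_finsetCard, hRn]
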